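/- Let $N$ and $r$ be positive integers with $N/2<r<N$. Let $J_r\subset\mathbb{C}[x_1,\ldots,x_N]$ be the ideal of all polynomials that vanish on every coordinate subspace $x_{i_1}=\cdots=x_{i_{r+1}}=0$, where $1\leqslant i_1<\cdots<i_{r+1}\leqslant N$. Then for every $f\in J_r$ the function $$ \Psi(x)=\frac{f(x)}{\prod_{1\leqslant i<j\leqslant N}(x_i^2-x_j^2)^{\frac{1}{2r}}} $$ is locally $L^2$-integrable on $\mathbb{R}^N$, that is, every point $P\in\mathbb{R}^N$ has a neighbourhood $U$ with $\int_U|\Psi(x)|^2\,dx<\infty$. (Powers of negative numbers are taken with their principal values; $|\Psi|$ does not depend on the choice of branch, and $\Psi$ may be given any value, for instance $0$, on the null set where the denominator vanishes.) -/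

import Mathlib

open MeasureTheory Topology

/-- The union of all coordinate subspaces `x_{i₁} = ⋯ = x_{i_{k+1}} = 0` of `ℂ^N`,
over all sets of `k + 1` distinct indices. -/
def coordinatePlanes (N k : ℕ) : Set (Fin N → ℂ) :=
  {x | ∃ S : Finset (Fin N), S.card = k + 1 ∧ ∀ i ∈ S, x i = 0}

/-- The ideal `J_k = J_k^N` of `ℂ[x_1, …, x_N]`: the polynomials vanishing on the union of the
coordinate subspaces of codimension `k + 1`. -/
noncomputable def idealJ (N k : ℕ) : Ideal (MvPolynomial (Fin N) ℂ) :=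
  MvPolynomial.vanishingIdeal ℂ (coordinatePlanes N k)

/-- The function `f / ∏_{i<j} (x_i² - x_j²)^c` on `ℝ^N`, for a complex polynomial `f` and a real
exponent `c`. Powers of negative reals are principal values; the modulus of the
function, hence its local square-integrability, does not depend on the branch. For `c ≠ 0` the
function has the value `0` on the null set where the denominator vanishes. -/
noncomputable def typeDQuotient (N : ℕ) (c : ℝ) (f : MvPolynomial (Fin N) ℂ)
    (x : Fin N → ℝ) : ℂ :=
  MvPolynomial.eval (fun i => (x i : ℂ)) f /
    ∏ i : Fin N, ∏ j ∈ Finset.Ioi i, ((((x i) ^ 2 - (x j) ^ 2 : ℝ) : ℂ) ^ (c : ℂ))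

/-- Local `L²`-integrability on `ℝ^N` (with Lebesgue measure): every point has a neighbourhood
on which the function is square-integrable. -/
def LocallyL2 {N : ℕ} (Ψ : (Fin N → ℝ) → ℂ) : Prop :=
  ∀ P : Fin N → ℝ, ∃ U ∈ 𝓝 P, MemLp Ψ 2 (volume.restrict U)

/-! Sort the coordinates by modulus, `y 0 < ... < y n` with `N = n + 1`; ties give the value `0`.
Every monomial of `f` involves at least `N - r` variables, so on bounded sets `|f|` is at most a
constant times the product of the `N - r` largest `y j` (`norm_eval_le_prod_top`).

Each factor of the denominator is bounded below by powers of `y j` and of the consecutive gaps `1 -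
y k / y (k + 1)`; every gap collects the total exponent `s = N / (2r)` (`prod_sq_sub_sq_ge`). The
powers of the `y j` are controlled by nonnegative scaling excesses (`prod_top_sq_mul_prod_le`).
Hence `|Ψ|²` is at most a constant times a product of scale-invariant kernels in consecutive pairs
(`prod_top_sq_div_le`). Integrating out the smallest variable repeatedly costs a constant each time,
finite because `s < 1` (`lintegral_chainProd_le`). Summing over all orderings finishes the proof. -/

/-! ### Integrals of chains of scale-invariant kernels. -/

/-- A scale-invariant kernel on `ℝ × ℝ`, supported on `|a| < |b|`, singular on `|a| = |b|`. -/
noncomputable def chainKernel (s a b : ℝ) : ENNReal :=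
  if |a| < |b| then ENNReal.ofReal (|b|⁻¹ * (1 - |a| / |b|) ^ (-s)) else 0

lemma Measurable.chainKernel {α : Type*} [MeasurableSpace α] {f g : α → ℝ} (s : ℝ)
    (hf : Measurable f) (hg : Measurable g) : Measurable fun a => chainKernel s (f a) (g a) := by
  unfold _root_.chainKernel
  refine Measurable.ite (measurableSet_lt (by fun_prop) (by fun_prop)) ?_ measurable_const
  fun_prop

lemma lintegral_rpow_neg_Ioc {s B : ℝ} (hs : s < 1) (hB : 0 ≤ B) :
    ∫⁻ t in Set.Ioc 0 B, ENNReal.ofReal (t ^ (-s)) = ENNReal.ofReal (B ^ (1 - s) / (1 - s)) := by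
  have hi : IntervalIntegrable (fun t : ℝ => t ^ (-s)) volume 0 B :=
    intervalIntegral.intervalIntegrable_rpow' (by linarith)
  rw [← ofReal_integral_eq_lintegral_ofReal ((intervalIntegrable_iff_integrableOn_Ioc_of_le hB).1 hi),
    ← intervalIntegral.integral_of_le hB, integral_rpow (Or.inl (by linarith))]
  · congr 1
    rw [Real.zero_rpow (by linarith)]
    ring_nf
  · filter_upwards [ae_restrict_mem measurableSet_Ioc] with t ht
    exact Real.rpow_nonneg ht.1.le _

/-- With `B = |b|` and `t = B - |a|` the kernel is `B ^ (s - 1) * t ^ (-s)` on `0 < t ≤ B`; scale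
invariance makes the bound independent of `b`. -/
lemma lintegral_chainKernel_le {s : ℝ} (hs : s < 1) (b : ℝ) :
    ∫⁻ a, chainKernel s a b ≤ 2 * ENNReal.ofReal (1 / (1 - s)) := by
  rcases eq_or_ne b 0 with rfl | hb
  · simp [chainKernel, (abs_nonneg _).not_gt]
  set B := |b| with hBdef
  have hB : 0 < B := abs_pos.2 hb
  set h : ℝ → ENNReal := (Set.Ioc 0 B).indicator
    (fun t => ENNReal.ofReal (B ^ (s - 1)) * ENNReal.ofReal (t ^ (-s))) with hh
  have hm : Measurable h := by
    refine Measurable.indicator ?_ measurableSet_Ioc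
    fun_prop
  have hint : ∫⁻ t, h t = ENNReal.ofReal (1 / (1 - s)) := by
    rw [hh, lintegral_indicator measurableSet_Ioc, lintegral_const_mul _ (by fun_prop),
      lintegral_rpow_neg_Ioc hs hB.le, ← ENNReal.ofReal_mul (by positivity), ← mul_div_assoc,
      ← Real.rpow_add hB]
    simp
  -- One summand for each sign of `a`; both are images of `h` under measure-preserving maps.
  have hle : ∀ a, chainKernel s a b ≤ h (B - a) + h (B + a) := by
    intro a
    unfold chainKernel
    split_ifs with hab
    swap
    · exact zero_le
    have key : ENNReal.ofReal (|b|⁻¹ * (1 - |a| / |b|) ^ (-s)) = h (B - |a|) := by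
      have : B - |a| ∈ Set.Ioc 0 B := ⟨by linarith, by linarith [abs_nonneg a]⟩
      rw [hh, Set.indicator_of_mem this, ← ENNReal.ofReal_mul (by positivity)]
      congr 1
      have e : 1 - |a| / B = (B - |a|) / B := by field_simp
      rw [← hBdef, e, Real.div_rpow this.1.le hB.le, Real.rpow_sub hB, Real.rpow_neg hB.le,
        Real.rpow_one]
      field_simp
    rw [key]
    rcases abs_cases a with ⟨h1, _⟩ | ⟨h1, _⟩
    · rw [h1]; exact le_self_add
    · rw [h1, sub_neg_eq_add]; exact le_add_self
  calc ∫⁻ a, chainKernel s a b ≤ ∫⁻ a, (h (B - a) + h (B + a)) := lintegral_mono hle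
    _ = (∫⁻ a, h (B - a)) + ∫⁻ a, h (B + a) := lintegral_add_left (by fun_prop) _
    _ = 2 * ENNReal.ofReal (1 / (1 - s)) := by
      rw [lintegral_sub_left_eq_self, lintegral_add_left_eq_self, hint, two_mul]

/-- The product of the kernel along consecutive coordinates, cut off in the last one. -/
noncomputable def chainProd (s R : ℝ) (n : ℕ) (x : Fin (n + 1) → ℝ) : ENNReal :=
  (∏ k : Fin n, chainKernel s (x k.castSucc) (x k.succ)) *
    (Set.Icc (-R) R).indicator 1 (x (Fin.last n))

lemma measurable_chainProd (s R : ℝ) (n : ℕ) : Measurable (chainProd s R n) := by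
  unfold chainProd
  refine Measurable.mul (Finset.measurable_prod _ fun k _ => ?_) ?_
  · exact (measurable_pi_apply k.castSucc).chainKernel s (measurable_pi_apply k.succ)
  · exact (measurable_one.indicator measurableSet_Icc).comp (measurable_pi_apply _)

/-- Coordinate `0` occurs in a single kernel, so it can be integrated out uniformly in the others,
leaving a shorter chain. -/
lemma lintegral_chainProd_le {s : ℝ} (hs : s < 1) (R : ℝ) (n : ℕ) :
    ∫⁻ x, chainProd s R n x ≤
      (2 * ENNReal.ofReal (1 / (1 - s))) ^ n * ENNReal.ofReal (2 * R) := by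
  induction n with
  | zero =>
    have e := (volume_preserving_funUnique (Fin 1) ℝ).lintegral_comp
      (f := (Set.Icc (-R) R).indicator 1) (measurable_one.indicator measurableSet_Icc)
    have : (fun x => chainProd s R 0 x) = fun x => (Set.Icc (-R) R).indicator 1
        ((MeasurableEquiv.funUnique (Fin 1) ℝ) x) := by
      funext x
      simp [chainProd]
    rw [this]
    refine (e.trans ?_).le
    rw [lintegral_indicator_one measurableSet_Icc, Real.volume_Icc]
    simp [two_mul]
  | succ n ih =>
    have e := (volume_preserving_piFinSuccAbove (fun _ : Fin (n + 2) => ℝ) 0).symm.lintegral_comp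
      (measurable_chainProd s R (n + 1))
    rw [← e]
    have h : ∀ p : ℝ × (Fin (n + 1) → ℝ),
        chainProd s R (n + 1) ((MeasurableEquiv.piFinSuccAbove (fun _ : Fin (n + 2) => ℝ) 0).symm p)
          = chainKernel s p.1 (p.2 0) * chainProd s R n p.2 := by
      intro p
      simp only [MeasurableEquiv.piFinSuccAbove_symm_apply, Fin.insertNthEquiv,
        Equiv.coe_fn_mk, Fin.insertNth_zero']
      rw [chainProd, Fin.prod_univ_succ, chainProd, ← Fin.succ_last]
      simp [mul_assoc]
    simp_rw [h]
    have hm : Measurable fun p : ℝ × (Fin (n + 1) → ℝ) =>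
        chainKernel s p.1 (p.2 0) * chainProd s R n p.2 := by
      refine Measurable.mul ?_ ((measurable_chainProd s R n).comp measurable_snd)
      exact measurable_fst.chainKernel s ((measurable_pi_apply 0).comp measurable_snd)
    rw [Measure.volume_eq_prod, lintegral_prod_symm _ hm.aemeasurable]
    calc _ ≤ ∫⁻ z : Fin (n + 1) → ℝ, 2 * ENNReal.ofReal (1 / (1 - s)) * chainProd s R n z := by
          refine lintegral_mono fun z => ?_
          dsimp only
          rw [lintegral_mul_const _ (measurable_id'.chainKernel s measurable_const)]
          gcongr
          exact lintegral_chainKernel_le hs _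
      _ ≤ _ := by
          rw [lintegral_const_mul _ (measurable_chainProd s R n), pow_succ', mul_assoc _ (_ ^ n)]
          gcongr

lemma lintegral_chainProd_comp_perm (s R : ℝ) (n : ℕ) (σ : Equiv.Perm (Fin (n + 1))) :
    ∫⁻ x : Fin (n + 1) → ℝ, chainProd s R n (fun i => x (σ i)) = ∫⁻ x, chainProd s R n x := by
  have e := (volume_measurePreserving_piCongrLeft (fun _ : Fin (n + 1) => ℝ) σ.symm).lintegral_comp
    (measurable_chainProd s R n)
  rw [← e]
  congr 1
  funext x
  congr 1
  funext i
  obtain ⟨j, rfl⟩ := σ.symm.surjective i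
  simp [MeasurableEquiv.coe_piCongrLeft, Equiv.piCongrLeft_apply_apply]

/-! ### Size of a polynomial in the ideal. -/

/-- A polynomial vanishing wherever `r + 1` coordinates vanish only involves monomials in at least
`N - r` variables. -/
lemma le_card_support_of_mem_idealJ {N r : ℕ} {f : MvPolynomial (Fin N) ℂ} (hf : f ∈ idealJ N r)
    {m : Fin N →₀ ℕ} (hm : m ∈ f.support) : N - r ≤ m.support.card := by
  by_contra hlt
  have hc : r + 1 ≤ (m.supportᶜ).card := by
    rw [Finset.card_compl, Fintype.card_fin]
    omega
  obtain ⟨S, hS, hcard⟩ := Finset.exists_subset_card_eq hc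
  set φ : MvPolynomial (Fin N) ℂ →ₐ[ℂ] MvPolynomial (Fin N) ℂ :=
    MvPolynomial.aeval fun i => if i ∈ S then 0 else MvPolynomial.X i with hφ
  have h0 : φ f = 0 := by
    refine MvPolynomial.funext fun x => ?_
    have := (MvPolynomial.mem_vanishingIdeal_iff.1 hf) (fun i => if i ∈ S then 0 else x i)
      ⟨S, hcard, fun i hi => by simp [hi]⟩
    rw [map_zero, ← this, hφ, ← MvPolynomial.coe_aeval_eq_eval, RingHom.coe_coe,
      ← AlgHom.comp_apply, MvPolynomial.comp_aeval]
    congr 2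
    funext i
    split_ifs <;> simp
  -- `φ` kills exactly the monomials meeting `S`, and `m` is not one of them.
  have hcoeff : ∀ p : MvPolynomial (Fin N) ℂ, (φ p).coeff m = p.coeff m := by
    intro p
    induction p using MvPolynomial.induction_on' with
    | add p q hp hq => simp [hp, hq]
    | monomial n a =>
      by_cases hn : ∃ i ∈ S, n i ≠ 0
      · obtain ⟨i, hi, hni⟩ := hn
        have hne : n ≠ m := by
          rintro rfl
          exact (Finset.mem_compl.1 (hS hi)) (Finsupp.mem_support_iff.2 hni)
        rw [MvPolynomial.coeff_monomial, if_neg hne, hφ, MvPolynomial.aeval_monomial,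
          Finsupp.prod, Finset.prod_eq_zero (Finsupp.mem_support_iff.2 hni)]
        · simp
        · simp [hi, hni]
      · push Not at hn
        have : φ (MvPolynomial.monomial n a) = MvPolynomial.monomial n a := by
          rw [hφ, MvPolynomial.aeval_monomial, MvPolynomial.monomial_eq]
          congr 1
          refine Finsupp.prod_congr fun i hi => ?_
          rw [if_neg fun hiS => (Finsupp.mem_support_iff.1 hi) (hn i hiS)]
        rw [this]
  have := hcoeff f
  rw [h0, MvPolynomial.coeff_zero] at this
  exact (MvPolynomial.mem_support_iff.1 hm) this.symm

/-- Among all sets of at least `N - r` values of a monotone tuple in `[0, R]`, the top values have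
the largest product up to a constant. -/
lemma prod_le_prod_top {N r : ℕ} {R : ℝ} (hR : 1 ≤ R) {y : Fin N → ℝ}
    (hy0 : ∀ i, 0 ≤ y i) (hyR : ∀ i, y i ≤ R) (hmono : Monotone y) {T : Finset (Fin N)}
    (hT : N - r ≤ T.card) :
    ∏ i ∈ T, y i ≤ R ^ N * ∏ i ∈ Finset.univ.filter fun i : Fin N => r ≤ i, y i := by
  classical
  set A  := Finset.univ.filter fun i : Fin N => r ≤ i with hA
  have hAc : A.card ≤ N - r := by
    have : A.card ≤ (Finset.Ico r N).card := by
      refine Finset.card_le_card_of_injOn (fun i => (i : ℕ)) ?_ (fun _ _ _ _ h => Fin.ext h)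
      intro i hi
      simp [hA] at hi
      simp [hi]
    simpa using this
  have hcard : (A \ T).card ≤ (T \ A).card := by
    have h1 := Finset.card_sdiff_add_card_inter A T
    have h2 := Finset.card_sdiff_add_card_inter T A
    rw [Finset.inter_comm] at h2
    omega
  have hnA : 0 ≤ ∏ i ∈ T ∩ A, y i := Finset.prod_nonneg fun i _ => hy0 i
  suffices h : ∏ i ∈ T \ A, y i ≤ R ^ N * ∏ i ∈ A \ T, y i by
    rw [← Finset.prod_inter_mul_prod_sdiff T A, ← Finset.prod_inter_mul_prod_sdiff A T,
      Finset.inter_comm A T]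
    calc _ ≤ (∏ i ∈ T ∩ A, y i) * (R ^ N * ∏ i ∈ A \ T, y i) := by gcongr
      _ = _ := by ring
  have hR0 : 0 ≤ R := by linarith
  by_cases hrN : r < N
  -- `θ` separates the values outside `A` from those in `A`; the surplus factors of `T \ A` are
  -- absorbed in `R ^ N`.
  · set θ := y ⟨r, hrN⟩ with hθ
    have hθ0 : 0 ≤ θ := hy0 _
    calc ∏ i ∈ T \ A, y i ≤ ∏ _i ∈ T \ A, θ := by
          refine Finset.prod_le_prod (fun i _ => hy0 i) fun i hi => hmono ?_
          simp [hA] at hi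
          exact Fin.le_def.2 hi.2.le
      _ = θ ^ ((T \ A).card - (A \ T).card) * θ ^ (A \ T).card := by
          rw [Finset.prod_const, ← pow_add, Nat.sub_add_cancel hcard]
      _ ≤ R ^ N * ∏ i ∈ A \ T, y i := by
          refine mul_le_mul ?_ ?_ (by positivity) (by positivity)
          · refine (pow_le_pow_left₀ hθ0 (hyR _) _).trans (pow_le_pow_right₀ hR ?_)
            have := Finset.card_le_univ (T \ A)
            rw [Fintype.card_fin] at this
            omega
          · rw [← Finset.prod_const]
            refine Finset.prod_le_prod (fun i _ => hθ0) fun i hi => hmono ?_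
            simp [hA] at hi
            exact Fin.le_def.2 hi.1
  · have hAe : A = ∅ := by
      refine Finset.filter_eq_empty_iff.2 fun i _ => ?_
      have := i.2
      omega
    rw [hAe]
    simp only [Finset.sdiff_empty, Finset.empty_sdiff, Finset.prod_empty, mul_one]
    calc ∏ i ∈ T, y i ≤ ∏ _i ∈ T, R := Finset.prod_le_prod (fun i _ => hy0 i) fun i _ => hyR i
      _ ≤ R ^ N := by
        rw [Finset.prod_const]
        refine pow_le_pow_right₀ hR ?_
        have := Finset.card_le_univ T
        rwa [Fintype.card_fin] at this

lemma norm_eval_le_prod_top {N r : ℕ} {f : MvPolynomial (Fin N) ℂ} (hf : f ∈ idealJ N r)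
    {R : ℝ} (hR : 1 ≤ R) :
    ∃ C : ℝ, 0 ≤ C ∧ ∀ x : Fin N → ℝ, (∀ i, |x i| ≤ R) → ∀ σ : Equiv.Perm (Fin N),
      (Monotone fun i => |x (σ i)|) →
        ‖MvPolynomial.eval (fun i => (x i : ℂ)) f‖ ≤
          C * ∏ i ∈ Finset.univ.filter fun i : Fin N => r ≤ i, |x (σ i)| := by
  have hR0 : 0 ≤ R := by linarith
  refine ⟨∑ m ∈ f.support, ‖f.coeff m‖ * (R ^ (∑ i, m i) * R ^ N), by positivity, ?_⟩
  intro x hx σ hσ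
  rw [MvPolynomial.eval_eq', Finset.sum_mul]
  refine (norm_sum_le _ _).trans (Finset.sum_le_sum fun m hm => ?_)
  rw [norm_mul, mul_assoc]
  gcongr
  rw [norm_prod, mul_assoc]
  have h1 : ∏ i, ‖(x i : ℂ) ^ m i‖ ≤ R ^ (∑ i, m i) * ∏ i ∈ m.support, |x i| := by
    rw [← Finset.prod_pow_eq_pow_sum, ← Finset.prod_subset (Finset.subset_univ m.support)
      (f := fun i => ‖(x i : ℂ) ^ m i‖), ← Finset.prod_subset (Finset.subset_univ m.support)
      (f := fun i => R ^ m i), ← Finset.prod_mul_distrib]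
    · refine Finset.prod_le_prod (fun i _ => norm_nonneg _) fun i hi => ?_
      rw [norm_pow, Complex.norm_real, Real.norm_eq_abs]
      obtain ⟨k, hk⟩ := Nat.exists_eq_succ_of_ne_zero (Finsupp.mem_support_iff.1 hi)
      rw [hk, pow_succ]
      refine mul_le_mul_of_nonneg_right ?_ (abs_nonneg _)
      exact (pow_le_pow_left₀ (abs_nonneg _) (hx i) _).trans (pow_le_pow_right₀ hR (Nat.le_succ k))
    · intro i _ hi
      simp [Finsupp.notMem_support_iff.1 hi]
    · intro i _ hi
      simp [Finsupp.notMem_support_iff.1 hi]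
  refine h1.trans ?_
  gcongr
  have h2 : ∏ i ∈ m.support, |x i| = ∏ i ∈ m.support.map σ.symm.toEmbedding, |x (σ i)| := by
    simp
  rw [h2]
  exact prod_le_prod_top hR (fun i => abs_nonneg _) (fun i => hx _) hσ
    (by simpa using le_card_support_of_mem_idealJ hf hm)

/-! ### Lower bound for the denominator by consecutive gaps. -/

/-- The ratio `u = y i / y j` is at most each of the two consecutive ratios, and `1 - u ≤ 1 - u ^
2`. -/
lemma sq_mul_gap_le {y : ℕ → ℝ} {N : ℕ} (hy0 : ∀ i, 0 ≤ y i)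
    (hy : ∀ i j, i < j → j < N → y i < y j) {i j : ℕ} (hij : i < j) (hj : j < N) :
    y j ^ 4 * ((1 - y i / y (i + 1)) * (1 - y (j - 1) / y j)) ≤ (y j ^ 2 - y i ^ 2) ^ 2 := by
  have mono : ∀ a b, a ≤ b → b < N → y a ≤ y b := fun a b hab hb => by
    rcases hab.eq_or_lt with rfl | h
    · rfl
    · exact (hy a b h hb).le
  have hyj : 0 < y j := (hy0 i).trans_lt (hy i j hij hj)
  have hyi : 0 < y (i + 1) := (hy0 i).trans_lt (hy i (i + 1) (by omega) (by omega))
  have h1 : y i / y j ≤ y i / y (i + 1) :=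
    div_le_div_of_nonneg_left (hy0 i) hyi (mono _ _ hij hj)
  have h2 : y i / y j ≤ y (j - 1) / y j :=
    div_le_div_of_nonneg_right (mono _ _ (by omega) (by omega)) hyj.le
  have h3 : y (j - 1) / y j ≤ 1 := (div_le_one hyj).2 (mono _ _ (by omega) hj)
  have hu : 0 ≤ y i / y j := div_nonneg (hy0 i) hyj.le
  have e : y j ^ 2 - y i ^ 2 = y j ^ 2 * (1 - (y i / y j) ^ 2) := by field_simp
  set u := y i / y j
  have hu1 : u ≤ 1 := h2.trans h3
  have h4 : (1 - y i / y (i + 1)) * (1 - y (j - 1) / y j) ≤ (1 - u) * (1 - u) :=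
    mul_le_mul (by linarith) (by linarith) (by linarith) (by linarith)
  have h5 : (1 - u) * (1 - u) ≤ (1 - u ^ 2) * (1 - u ^ 2) :=
    mul_self_le_mul_self (by linarith) (by nlinarith)
  calc _ ≤ y j ^ 4 * ((1 - u ^ 2) * (1 - u ^ 2)) :=
        mul_le_mul_of_nonneg_left (h4.trans h5) (by positivity)
    _ = _ := by rw [e]; ring

/-- Gap `k` appears `n - k` times as `w i` and `k + 1` times as `w (j - 1)`, hence `n + 1` times
whatever `k` is. -/
lemma prod_prod_gap (w : ℕ → ℝ) (n : ℕ) :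
    ∏ j ∈ Finset.range (n + 1), ∏ i ∈ Finset.range j, (w i * w (j - 1)) =
      (∏ k ∈ Finset.range n, w k) ^ (n + 1) := by
  induction n with
  | zero => simp
  | succ n ih =>
    rw [Finset.prod_range_succ, ih, Finset.prod_mul_distrib, Finset.prod_const, Finset.card_range,
      Nat.add_sub_cancel, Finset.prod_range_succ]
    ring

lemma prod_sq_sub_sq_ge {y : ℕ → ℝ} {n : ℕ} {c : ℝ} (hc : 0 ≤ c) (hy0 : ∀ i, 0 ≤ y i)
    (hy : ∀ i j, i < j → j < n + 1 → y i < y j) :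
    (∏ j ∈ Finset.range (n + 1), y j ^ (4 * j)) ^ c *
        ∏ k ∈ Finset.range n, (1 - y k / y (k + 1)) ^ ((n + 1 : ℕ) * c) ≤
      ∏ j ∈ Finset.range (n + 1), ∏ i ∈ Finset.range j, ((y j ^ 2 - y i ^ 2) ^ 2) ^ c := by
  have hw : ∀ k ∈ Finset.range n, 0 ≤ 1 - y k / y (k + 1) := fun k hk => by
    rw [Finset.mem_range] at hk
    have := hy k (k + 1) (by omega) (by omega)
    rw [sub_nonneg]
    exact (div_le_one ((hy0 k).trans_lt this)).2 this.le
  have e : (∏ j ∈ Finset.range (n + 1), y j ^ (4 * j)) ^ c *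
        ∏ k ∈ Finset.range n, (1 - y k / y (k + 1)) ^ ((n + 1 : ℕ) * c) =
      (∏ j ∈ Finset.range (n + 1), ∏ i ∈ Finset.range j,
        (y j ^ 4 * ((1 - y i / y (i + 1)) * (1 - y (j - 1) / y j)))) ^ c := by
    have h := prod_prod_gap (fun k => 1 - y k / y (k + 1)) n
    have h' : ∏ j ∈ Finset.range (n + 1), ∏ i ∈ Finset.range j,
        ((1 - y i / y (i + 1)) * (1 - y (j - 1) / y j)) =
          (∏ k ∈ Finset.range n, (1 - y k / y (k + 1))) ^ (n + 1) := by
      rw [← h]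
      refine Finset.prod_congr rfl fun j _ => Finset.prod_congr rfl fun i hi => ?_
      rw [Finset.mem_range] at hi
      rw [Nat.sub_add_cancel (by omega)]
    simp_rw [Finset.prod_mul_distrib (f := fun _ => y _ ^ 4)]
    rw [Finset.prod_mul_distrib, h', Real.mul_rpow, Real.finsetProd_rpow _ _ hw, Real.rpow_mul,
      Real.rpow_natCast]
    · simp_rw [Finset.prod_const, Finset.card_range, pow_mul]
    · exact Finset.prod_nonneg hw
    · exact Finset.prod_nonneg fun j _ => Finset.prod_nonneg fun i _ => pow_nonneg (hy0 j) 4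
    · exact pow_nonneg (Finset.prod_nonneg hw) _
  rw [e]
  have hnn : ∀ j ∈ Finset.range (n + 1), ∀ i ∈ Finset.range j,
      0 ≤ y j ^ 4 * ((1 - y i / y (i + 1)) * (1 - y (j - 1) / y j)) := by
    intro j hj i hi
    rw [Finset.mem_range] at hj hi
    have h1 := hw (j - 1) (Finset.mem_range.2 (by omega))
    rw [Nat.sub_add_cancel (by omega)] at h1
    exact mul_nonneg (pow_nonneg (hy0 j) 4) (mul_nonneg (hw i (Finset.mem_range.2 (by omega))) h1)
  rw [← Real.finsetProd_rpow _ _ fun j hj => Finset.prod_nonneg (hnn j hj)]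
  refine Finset.prod_le_prod (fun j hj => Real.rpow_nonneg (Finset.prod_nonneg (hnn j hj)) _)
    fun j hj => ?_
  rw [← Real.finsetProd_rpow _ _ (hnn j hj)]
  refine Finset.prod_le_prod (fun i hi => Real.rpow_nonneg (hnn j hj i hi) _) fun i hi => ?_
  exact Real.rpow_le_rpow (hnn j hj i hi)
    (sq_mul_gap_le hy0 hy (Finset.mem_range.1 hi) (Finset.mem_range.1 hj)) hc

/-! ### Power counting. -/

/-- The scaling excess at the flat where the smallest `k + 1` coordinates vanish. -/
noncomputable def scalingExcess (r k : ℕ) : ℝ :=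
  k + 2 * ((k + 1 - r : ℕ) : ℝ) - k * (k + 1) / r

/-- After multiplication by `r` the excess is `k * (r - k - 1)` for `k + 1 ≤ r`, and `(k + 1 - r) *
(2 * r - k)` otherwise. -/
lemma scalingExcess_nonneg {r k : ℕ} (hr : 0 < r) (hk : k + 1 ≤ 2 * r) :
    0 ≤ scalingExcess r k := by
  have hr' : (0 : ℝ) < r := by exact_mod_cast hr
  have e : scalingExcess r k * r = (k + 2 * ((k + 1 - r : ℕ) : ℝ)) * r - k * (k + 1) := by
    unfold scalingExcess
    field_simp
  refine nonneg_of_mul_nonneg_left (b := (r : ℝ)) ?_ hr'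
  rw [e]
  have hk' : (k : ℝ) + 1 ≤ 2 * r := by exact_mod_cast hk
  rcases le_total (k + 1) r with h | h
  · rw [Nat.sub_eq_zero_of_le h]
    have h' : (k : ℝ) + 1 ≤ r := by exact_mod_cast h
    have : (0 : ℝ) ≤ k := by positivity
    push_cast
    nlinarith
  · rw [Nat.cast_sub h]
    have h' : (r : ℝ) ≤ k + 1 := by exact_mod_cast h
    push_cast
    nlinarith [mul_nonneg (sub_nonneg.2 h') (sub_nonneg.2 hk')]

/-- A multiplicative Abel summation: the excess accumulated on `y n` is passed to the larger `y (n +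
1)`, which is allowed because it is nonnegative. -/
lemma prod_top_sq_mul_prod_le {y : ℕ → ℝ} {n r : ℕ} (hr : 0 < r) (hn : n + 1 ≤ 2 * r)
    (hy0 : ∀ i, 0 ≤ y i) (hy : ∀ i j, i < j → j < n + 1 → y i < y j) :
    (∏ j ∈ Finset.range (n + 1) with r ≤ j, y j) ^ 2 * ∏ k ∈ Finset.range n, y (k + 1) ≤
      y n ^ scalingExcess r n *
        (∏ j ∈ Finset.range (n + 1), y j ^ (4 * j)) ^ (1 / (2 * (r : ℝ))) := by
  have hr' : (0 : ℝ) < r := by exact_mod_cast hr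
  induction n with
  | zero =>
    have : scalingExcess r 0 = 0 := by simp [scalingExcess, Nat.sub_eq_zero_of_le hr]
    rw [this]
    simp [Finset.filter_singleton, hr.ne']
  | succ n ih =>
    specialize ih (by omega) fun i j hij hj => hy i j hij (by omega)
    have hlt := hy n (n + 1) (by omega) (by omega)
    have hpos : 0 < y (n + 1) := (hy0 n).trans_lt hlt
    set c : ℝ := 1 / (2 * (r : ℝ)) with hc
    set d : ℕ := if r ≤ n + 1 then 1 else 0 with hd
    have h1 : ∏ j ∈ Finset.range (n + 1 + 1) with r ≤ j, y j =
        (∏ j ∈ Finset.range (n + 1) with r ≤ j, y j) * y (n + 1) ^ d := by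
      rw [Finset.prod_filter, Finset.prod_range_succ, ← Finset.prod_filter, hd]
      split_ifs <;> simp
    -- Balance of the exponents of `y (n + 1)`: `2 * d` from the numerator, `1` from the kernel, `4
    -- * (n + 1) * c` from the denominator.
    have hs : scalingExcess r n + ((2 * d + 1 : ℕ) : ℝ) =
        scalingExcess r (n + 1) + ((4 * (n + 1) : ℕ) : ℝ) * c := by
      have : n + 1 + 1 - r = n + 1 - r + d := by
        rw [hd]; split_ifs <;> omega
      unfold scalingExcess
      rw [this, hc]
      push_cast
      field_simp
      ring
    have hY : 0 ≤ ∏ j ∈ Finset.range (n + 1), y j ^ (4 * j) :=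
      Finset.prod_nonneg fun j _ => pow_nonneg (hy0 j) _
    rw [h1, Finset.prod_range_succ _ n, Finset.prod_range_succ _ (n + 1), Real.mul_rpow hY
      (by positivity), ← Real.rpow_natCast (y (n + 1)) (4 * (n + 1)), ← Real.rpow_mul hpos.le]
    calc _ = ((∏ j ∈ Finset.range (n + 1) with r ≤ j, y j) ^ 2 *
            ∏ k ∈ Finset.range n, y (k + 1)) * y (n + 1) ^ (2 * d + 1) := by ring
      _ ≤ (y n ^ scalingExcess r n * (∏ j ∈ Finset.range (n + 1), y j ^ (4 * j)) ^ c) *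
            y (n + 1) ^ (2 * d + 1) := by gcongr
      _ ≤ (y (n + 1) ^ scalingExcess r n * (∏ j ∈ Finset.range (n + 1), y j ^ (4 * j)) ^ c) *
            y (n + 1) ^ (2 * d + 1) := by
          gcongr
          · exact hy0 n
          · exact scalingExcess_nonneg hr (by omega)
      _ = (y (n + 1) ^ (scalingExcess r n + ((2 * d + 1 : ℕ) : ℝ))) *
            (∏ j ∈ Finset.range (n + 1), y j ^ (4 * j)) ^ c := by
          rw [Real.rpow_add hpos, Real.rpow_natCast]
          ring
      _ = _ := by
          rw [hs, Real.rpow_add hpos]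
          ring

lemma prod_top_sq_div_le {y : ℕ → ℝ} {n r : ℕ} {R : ℝ} (hr : 0 < r) (hn : n + 1 ≤ 2 * r)
    (hy0 : ∀ i, 0 ≤ y i) (hyR : y n ≤ R) (hy : ∀ i j, i < j → j < n + 1 → y i < y j) :
    (∏ j ∈ Finset.range (n + 1) with r ≤ j, y j) ^ 2 /
        ∏ j ∈ Finset.range (n + 1), ∏ i ∈ Finset.range j,
          ((y j ^ 2 - y i ^ 2) ^ 2) ^ (1 / (2 * (r : ℝ))) ≤
      R ^ scalingExcess r n * ∏ k ∈ Finset.range n,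
        ((y (k + 1))⁻¹ * (1 - y k / y (k + 1)) ^ (-((n + 1 : ℕ) * (1 / (2 * (r : ℝ)))))) := by
  have hypos : ∀ j, 0 < j → j < n + 1 → 0 < y j := fun j h0 hj =>
    (hy0 0).trans_lt (hy 0 j h0 hj)
  have hw : ∀ k ∈ Finset.range n, 0 < 1 - y k / y (k + 1) := fun k hk => by
    rw [Finset.mem_range] at hk
    rw [sub_pos, div_lt_one (hypos _ (by omega) (by omega))]
    exact hy k (k + 1) (by omega) (by omega)
  have hD := prod_sq_sub_sq_ge (c := 1 / (2 * (r : ℝ))) (by positivity) hy0 hy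
  have hA := prod_top_sq_mul_prod_le hr hn hy0 hy
  set c : ℝ := 1 / (2 * (r : ℝ))
  have hE : y n ^ scalingExcess r n ≤ R ^ scalingExcess r n :=
    Real.rpow_le_rpow (hy0 n) hyR (scalingExcess_nonneg hr hn)
  have hY : 0 < (∏ j ∈ Finset.range (n + 1), y j ^ (4 * j)) ^ c := by
    refine Real.rpow_pos_of_pos (Finset.prod_pos fun j hj => ?_) _
    -- `y 0` may vanish, but its exponent is `0`.
    rcases Nat.eq_zero_or_pos j with rfl | h
    · simp
    · exact pow_pos (hypos j h (Finset.mem_range.1 hj)) _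
  have hW : 0 < ∏ k ∈ Finset.range n, (1 - y k / y (k + 1)) ^ ((n + 1 : ℕ) * c) :=
    Finset.prod_pos fun k hk => Real.rpow_pos_of_pos (hw k hk) _
  have hZ : 0 < ∏ k ∈ Finset.range n, y (k + 1) :=
    Finset.prod_pos fun k hk => hypos _ (by omega) (by rw [Finset.mem_range] at hk; omega)
  have e : ∏ k ∈ Finset.range n,
        ((y (k + 1))⁻¹ * (1 - y k / y (k + 1)) ^ (-((n + 1 : ℕ) * c))) =
      (∏ k ∈ Finset.range n, y (k + 1))⁻¹ *
        (∏ k ∈ Finset.range n, (1 - y k / y (k + 1)) ^ ((n + 1 : ℕ) * c))⁻¹ := by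
    rw [Finset.prod_mul_distrib, Finset.prod_inv_distrib,
      ← Finset.prod_inv_distrib (fun k => _ ^ _)]
    congr 1
    exact Finset.prod_congr rfl fun k hk => Real.rpow_neg (hw k hk).le _
  rw [e]
  set A := (∏ j ∈ Finset.range (n + 1) with r ≤ j, y j) ^ 2
  set Y := (∏ j ∈ Finset.range (n + 1), y j ^ (4 * j)) ^ c
  set W := ∏ k ∈ Finset.range n, (1 - y k / y (k + 1)) ^ ((n + 1 : ℕ) * c)
  set Z := ∏ k ∈ Finset.range n, y (k + 1)
  have hA0 : 0 ≤ A := sq_nonneg _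
  calc _ ≤ A / (Y * W) := by gcongr
    _ = (A * Z) * (Y⁻¹ * Z⁻¹ * W⁻¹) := by field_simp
    _ ≤ (R ^ scalingExcess r n * Y) * (Y⁻¹ * Z⁻¹ * W⁻¹) := by
        refine mul_le_mul_of_nonneg_right (hA.trans ?_) (by positivity)
        exact mul_le_mul_of_nonneg_right hE hY.le
    _ = _ := by field_simp

/-! ### Pointwise bound of the quotient by kernel chains. -/

lemma norm_typeDQuotient (N : ℕ) (c : ℝ) (f : MvPolynomial (Fin N) ℂ) (x : Fin N → ℝ) :
    ‖typeDQuotient N c f x‖ = ‖MvPolynomial.eval (fun i => (x i : ℂ)) f‖ /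
      ∏ i : Fin N, ∏ j ∈ Finset.Ioi i, |x i ^ 2 - x j ^ 2| ^ c := by
  simp only [typeDQuotient, norm_div, norm_prod, Complex.norm_cpow_real, Complex.norm_real,
    Real.norm_eq_abs]

lemma typeDQuotient_eq_zero {N : ℕ} {c : ℝ} (hc : c ≠ 0) (f : MvPolynomial (Fin N) ℂ)
    {x : Fin N → ℝ} (hx : ¬ Function.Injective fun i => |x i|) : typeDQuotient N c f x = 0 := by
  simp only [Function.Injective, not_forall] at hx
  obtain ⟨a, b, hab, hne⟩ := hx
  wlog hlt : a < b generalizing a b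
  · exact this b a hab.symm (Ne.symm hne) (lt_of_le_of_ne (not_lt.1 hlt) (Ne.symm hne))
  rw [← norm_eq_zero, norm_typeDQuotient]
  rw [Finset.prod_eq_zero (Finset.mem_univ a), div_zero]
  refine Finset.prod_eq_zero (Finset.mem_Ioi.2 hlt) ?_
  rw [(sq_eq_sq_iff_abs_eq_abs _ _).2 hab, sub_self, abs_zero, Real.zero_rpow hc]

/-- The squared product runs over all ordered pairs of distinct indices, so it is invariant under
permutations. -/
lemma prod_Ioi_sq_comp_perm {N : ℕ} (c : ℝ) (x : Fin N → ℝ) (σ : Equiv.Perm (Fin N)) :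
    (∏ i : Fin N, ∏ j ∈ Finset.Ioi i, |x i ^ 2 - x j ^ 2| ^ c) ^ 2 =
      ∏ j : Fin N, ∏ i ∈ Finset.Iio j, ((x (σ j) ^ 2 - x (σ i) ^ 2) ^ 2) ^ c := by
  have hsq : ∀ a b : ℝ, |a - b| ^ c * |b - a| ^ c = ((a - b) ^ 2) ^ c := fun a b => by
    rw [abs_sub_comm b a, ← Real.mul_rpow (abs_nonneg _) (abs_nonneg _), ← sq, sq_abs]
  have hoff : ∀ z : Fin N → ℝ, ∏ i : Fin N, ∏ j ∈ Finset.Ioi i, ((z j ^ 2 - z i ^ 2) ^ 2) ^ c =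
      ∏ i : Fin N, ∏ j : Fin N, if j = i then 1 else |z j ^ 2 - z i ^ 2| ^ c := fun z => by
    have := Finset.prod_prod_Ioi_mul_eq_prod_prod_off_diag
      (fun j i : Fin N => |z j ^ 2 - z i ^ 2| ^ c)
    simp_rw [hsq] at this
    rw [this]
    refine Finset.prod_congr rfl fun i _ => ?_
    rw [← Finset.prod_subset (Finset.subset_univ {i}ᶜ)
      (f := fun j => if j = i then 1 else |z j ^ 2 - z i ^ 2| ^ c)]
    · refine Finset.prod_congr rfl fun j hj => ?_
      rw [if_neg (by simpa using hj)]
    · intro j _ hj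
      rw [if_pos (by simpa using hj)]
  have h1 : (∏ i : Fin N, ∏ j ∈ Finset.Ioi i, |x i ^ 2 - x j ^ 2| ^ c) ^ 2 =
      ∏ i : Fin N, ∏ j ∈ Finset.Ioi i, ((x j ^ 2 - x i ^ 2) ^ 2) ^ c := by
    simp_rw [sq (∏ _, _), ← Finset.prod_mul_distrib]
    refine Finset.prod_congr rfl fun i _ => Finset.prod_congr rfl fun j _ => ?_
    rw [← hsq, abs_sub_comm]
  have h2 : ∏ j : Fin N, ∏ i ∈ Finset.Iio j, ((x (σ j) ^ 2 - x (σ i) ^ 2) ^ 2) ^ c =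
      ∏ i : Fin N, ∏ j ∈ Finset.Ioi i, ((x (σ j) ^ 2 - x (σ i) ^ 2) ^ 2) ^ c :=
    Finset.prod_comm' (by simp)
  rw [h1, hoff x, h2, hoff fun i => x (σ i), ← Equiv.prod_comp σ]
  refine Finset.prod_congr rfl fun i _ => ?_
  rw [← Equiv.prod_comp σ]
  simp

lemma norm_sq_typeDQuotient_le {n r : ℕ} (hr : 0 < r) (hn : n + 1 ≤ 2 * r)
    {f : MvPolynomial (Fin (n + 1)) ℂ} (hf : f ∈ idealJ (n + 1) r) {R : ℝ} (hR : 1 ≤ R) :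
    ∃ K : ℝ, 0 ≤ K ∧ ∀ x : Fin (n + 1) → ℝ, (∀ i, |x i| ≤ R) → ∀ σ : Equiv.Perm (Fin (n + 1)),
      (StrictMono fun i => |x (σ i)|) →
        ‖typeDQuotient (n + 1) (1 / (2 * (r : ℝ))) f x‖ ^ 2 ≤ K * ∏ k : Fin n,
          (|x (σ k.succ)|⁻¹ * (1 - |x (σ k.castSucc)| / |x (σ k.succ)|) ^
            (-((n + 1 : ℕ) * (1 / (2 * (r : ℝ)))))) := by
  obtain ⟨C, hC, hfC⟩ := norm_eval_le_prod_top hf hR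
  refine ⟨C ^ 2 * R ^ scalingExcess r n, by positivity, fun x hx σ hσ => ?_⟩
  set y : ℕ → ℝ := fun k => if h : k < n + 1 then |x (σ ⟨k, h⟩)| else 0 with hy
  have hyv : ∀ i : Fin (n + 1), |x (σ i)| = y i := fun i => by simp only [hy, i.2, dif_pos]
  have hy0 : ∀ i, 0 ≤ y i := fun i => by
    simp only [hy]
    split_ifs
    · exact abs_nonneg _
    · rfl
  have hylt : ∀ i j, i < j → j < n + 1 → y i < y j := fun i j hij hj => by
    have := hσ (show (⟨i, hij.trans hj⟩ : Fin (n + 1)) < ⟨j, hj⟩ from hij)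
    simpa only [hyv] using this
  have hyR : y n ≤ R := by
    rw [show y n = |x (σ (Fin.last n))| from (hyv (Fin.last n)).symm]
    exact hx _
  have hmain := prod_top_sq_div_le hr hn hy0 hyR hylt
  have hfx := hfC x hx σ hσ.monotone
  simp_rw [hyv] at hfx ⊢
  rw [norm_typeDQuotient, div_pow, prod_Ioi_sq_comp_perm _ x σ]
  set c : ℝ := 1 / (2 * (r : ℝ))
  have hden : ∏ j : Fin (n + 1), ∏ i ∈ Finset.Iio j, ((x (σ j) ^ 2 - x (σ i) ^ 2) ^ 2) ^ c =
      ∏ j ∈ Finset.range (n + 1), ∏ i ∈ Finset.range j, ((y j ^ 2 - y i ^ 2) ^ 2) ^ c := by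
    rw [← Fin.prod_univ_eq_prod_range
      (fun j => ∏ i ∈ Finset.range j, ((y j ^ 2 - y i ^ 2) ^ 2) ^ c)]
    refine Finset.prod_congr rfl fun j _ => ?_
    rw [← Nat.Iio_eq_range, ← Fin.map_valEmbedding_Iio, Finset.prod_map]
    refine Finset.prod_congr rfl fun i _ => ?_
    rw [Fin.valEmbedding_apply, ← hyv, ← hyv, sq_abs, sq_abs]
  have htop : ∏ i ∈ Finset.univ.filter fun i : Fin (n + 1) => r ≤ i, y i =
      ∏ j ∈ Finset.range (n + 1) with r ≤ j, y j := by
    rw [Finset.prod_filter, Finset.prod_filter,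
      ← Fin.prod_univ_eq_prod_range (fun j => if r ≤ j then y j else 1)]
  rw [htop] at hfx
  rw [hden]
  have hprod := Fin.prod_univ_eq_prod_range
    (fun k => (y (k + 1))⁻¹ * (1 - y k / y (k + 1)) ^ (-((n + 1 : ℕ) * c))) n
  simp only [Fin.val_succ, Fin.val_castSucc]
  rw [hprod, mul_assoc]
  refine le_trans ?_ (mul_le_mul_of_nonneg_left hmain (sq_nonneg C))
  rw [← mul_div_assoc, ← mul_pow]
  refine div_le_div_of_nonneg_right (pow_le_pow_left₀ (norm_nonneg _) hfx 2) ?_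
  exact Finset.prod_nonneg fun j _ => Finset.prod_nonneg fun i _ => by positivity

lemma enorm_sq_typeDQuotient_le {n r : ℕ} (hr : 0 < r) (hn : n + 1 ≤ 2 * r)
    {f : MvPolynomial (Fin (n + 1)) ℂ} (hf : f ∈ idealJ (n + 1) r) {R : ℝ} (hR : 1 ≤ R) :
    ∃ K : ℝ, ∀ x : Fin (n + 1) → ℝ, (∀ i, |x i| ≤ R) →
      ‖typeDQuotient (n + 1) (1 / (2 * (r : ℝ))) f x‖ₑ ^ 2 ≤
        ENNReal.ofReal K * ∑ σ : Equiv.Perm (Fin (n + 1)),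
          chainProd ((n + 1 : ℕ) * (1 / (2 * (r : ℝ)))) R n fun i => x (σ i) := by
  obtain ⟨K, hK, hKx⟩ := norm_sq_typeDQuotient_le hr hn hf hR
  refine ⟨K, fun x hx => ?_⟩
  by_cases hinj : Function.Injective fun i => |x i|
  swap
  · have hr' : (r : ℝ) ≠ 0 := by exact_mod_cast hr.ne'
    rw [typeDQuotient_eq_zero (by simpa using hr') f hinj]
    simp
  set σ := Tuple.sort fun i => |x i|
  have hσ : StrictMono fun i => |x (σ i)| :=
    (Tuple.monotone_sort fun i => |x i|).strictMono_of_injective (hinj.comp σ.injective)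
  -- Only the sorting permutation is needed; the sum over all of them avoids a choice depending on
  -- `x`.
  refine le_trans ?_ (mul_le_mul_right (Finset.single_le_sum (fun _ _ => zero_le)
    (Finset.mem_univ σ)) _)
  have hlast : x (σ (Fin.last n)) ∈ Set.Icc (-R) R := abs_le.1 (hx _)
  rw [chainProd, Set.indicator_of_mem hlast, Pi.one_apply, mul_one]
  have hker : ∀ k : Fin n, |x (σ k.castSucc)| < |x (σ k.succ)| := fun k =>
    hσ (Fin.castSucc_lt_succ)
  simp only [chainKernel, if_pos (hker _)]
  rw [← ENNReal.ofReal_prod_of_nonneg, ← ENNReal.ofReal_mul hK, ← ofReal_norm,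
    ← ENNReal.ofReal_pow (norm_nonneg _)]
  · exact ENNReal.ofReal_le_ofReal (hKx x hx σ hσ)
  · intro k _
    have h0 : 0 ≤ |x (σ k.castSucc)| := abs_nonneg _
    refine mul_nonneg (inv_nonneg.2 (abs_nonneg _)) (Real.rpow_nonneg ?_ _)
    rw [sub_nonneg]
    exact (div_le_one (h0.trans_lt (hker k))).2 (hker k).le

/-! ### Measurability and conclusion. -/

lemma measurable_typeDQuotient (N : ℕ) (c : ℝ) (f : MvPolynomial (Fin N) ℂ) :
    Measurable (typeDQuotient N c f) := by
  unfold typeDQuotient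
  refine Measurable.div ?_ ?_
  · refine Continuous.measurable ?_
    exact (MvPolynomial.continuous_eval f).comp (by fun_prop)
  · refine Finset.measurable_prod _ fun i _ => Finset.measurable_prod _ fun j _ => ?_
    exact Measurable.pow_const (by fun_prop) _

theorem mainTheorem3 (N r : ℕ) (hr : (N : ℝ) / 2 < (r : ℝ)) (hrN : r < N)
    (f : MvPolynomial (Fin N) ℂ) (hf : f ∈ idealJ N r) :
    LocallyL2 (typeDQuotient N (1 / (2 * (r : ℝ))) f) := by
  obtain ⟨n, rfl⟩ : ∃ n, N = n + 1 := ⟨N - 1, by omega⟩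
  have hr2 : ((n + 1 : ℕ) : ℝ) < 2 * r := by linarith
  have hn : n + 1 < 2 * r := by exact_mod_cast hr2
  have hr0 : 0 < r := by omega
  intro P
  set R : ℝ := ‖P‖ + 1 with hRdef
  have hR : 1 ≤ R := by linarith [norm_nonneg P]
  refine ⟨Metric.ball 0 R, Metric.isOpen_ball.mem_nhds (by simp [hRdef]),
    (measurable_typeDQuotient _ _ f).aestronglyMeasurable, ?_⟩
  rw [eLpNorm_lt_top_iff_lintegral_rpow_enorm_lt_top two_ne_zero ENNReal.ofNat_ne_top]
  obtain ⟨K, hK⟩ := enorm_sq_typeDQuotient_le hr0 hn.le hf hR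
  set s : ℝ := (n + 1 : ℕ) * (1 / (2 * (r : ℝ))) with hs
  -- The strict inequality `N / 2 < r` is what makes the gap singularities integrable.
  have hs1 : s < 1 := by
    rw [hs, mul_one_div, div_lt_one (by linarith [(n + 1).cast_nonneg (α := ℝ)])]
    exact hr2
  have hmeas : ∀ σ : Equiv.Perm (Fin (n + 1)),
      Measurable fun x : Fin (n + 1) → ℝ => chainProd s R n fun i => x (σ i) := fun σ =>
    (measurable_chainProd s R n).comp (measurable_pi_lambda _ fun i => measurable_pi_apply _)
  have h2 : (2 : ENNReal).toReal = ((2 : ℕ) : ℝ) := by simp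
  simp_rw [h2, ENNReal.rpow_natCast]
  have hle : ∫⁻ x in Metric.ball 0 R, ‖typeDQuotient (n + 1) (1 / (2 * (r : ℝ))) f x‖ₑ ^ 2 ≤
      ∫⁻ x in Metric.ball (0 : Fin (n + 1) → ℝ) R,
        ENNReal.ofReal K * ∑ σ : Equiv.Perm (Fin (n + 1)),
        chainProd s R n fun i => x (σ i) := by
    refine setLIntegral_mono' measurableSet_ball fun x hx => hK x fun i => ?_
    exact (norm_le_pi_norm x i).trans (mem_ball_zero_iff.1 hx).le
  refine (hle.trans (setLIntegral_le_lintegral _ _)).trans_lt ?_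
  rw [lintegral_const_mul _ (Finset.measurable_fun_sum _ fun σ _ => hmeas σ),
    lintegral_finsetSum _ fun σ _ => hmeas σ]
  simp_rw [lintegral_chainProd_comp_perm]
  refine ENNReal.mul_lt_top ENNReal.ofReal_lt_top (ENNReal.sum_lt_top.2 fun σ _ => ?_)
  refine (lintegral_chainProd_le hs1 R n).trans_lt (ENNReal.mul_lt_top ?_ ENNReal.ofReal_lt_top)
  exact ENNReal.pow_lt_top (ENNReal.mul_lt_top ENNReal.ofNat_lt_top ENNReal.ofReal_lt_top)
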